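/- Let $\mathcal{X}=\mathbb{C}^n$ with $n\ge 1$, let $L(\mathcal{X})$ be the space of linear operators on $\mathcal{X}$ with matrix units $E_{i,j}$, and let $\mathrm{HP}(\mathcal{X})$ be the real vector space of Hermitian-preserving linear maps $L(\mathcal{X})\to L(\mathcal{X})$, a Euclidean space for the Hilbert–Schmidt inner product of the Choi representations $J(\Phi)=\sum_{i,j}E_{i,j}\otimes\Phi(E_{i,j})$. A channel is a completely positive trace-preserving linear map. Let $\mathrm{Comp}\subset \mathrm{HP}(\mathcal{X})\oplus\mathrm{HP}(\mathcal{X})$ be the set of pairs $(\Phi_1,\Phi_2)$ of channels on $\mathcal{X}$ that are compatible, i.e. for which there is a channel $\Phi:L(\mathcal{X})\to L(\mathcal{X}_1\otimes\mathcal{X}_2)$, $\mathcal{X}_1=\mathcal{X}_2=\mathcal{X}$, with $\Phi_1(X)=\mathrm{Tr}_{\mathcal{X}_2}(\Phi(X))$ and $\Phi_2(X)=\mathrm{Tr}_{\mathcal{X}_1}(\Phi(X))$ for all $X\in L(\mathcal{X})$. Let $\mathrm{JComp}$ be the set of pairs $(\Phi_1,\Phi_2)$ of channels on $\mathcal{X}$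 that are Jordan compatible, i.e. for which there is a Hermitian operator $A$ on $\mathcal{X}\otimes\mathcal{X}_1\otimes\mathcal{X}_2$ with $\mathrm{Tr}_{\mathcal{X}_1}(A)=\mathrm{Tr}_{\mathcal{X}_2}(A)=\sum_{i,j}E_{i,j}\otimes E_{i,j}$ such that the linear map $\Phi_1\odot_A\Phi_2:L(\mathcal{X})\to L(\mathcal{X}_1\otimes\mathcal{X}_2)$ with Choi representation $J(\Phi_1\odot_A\Phi_2)=(\mathrm{id}_{L(\mathcal{X})}\otimes\Phi_1\otimes\Phi_2)(A)$ is completely positive. Then: 1. $\mathrm{JComp}$ has full measure as a subset of $\mathrm{Comp}$, i.e. $\mathrm{Comp}\setminus\mathrm{JComp}$ is a null set for the Lebesgue measure induced by the Euclidean space $\mathrm{HP}(\mathcal{X})\oplus\mathrm{HP}(\mathcal{X})$ on its affine subspace of pairs of trace-preserving maps. 2. $\overline{\mathrm{JComp}}=\mathrm{Comp}$, where the closure is taken in $\mathrm{HP}(\mathcal{X})\oplus\mathrm{HP}(\mathcal{X})$. -/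

import Mathlib

open scoped Matrix Kronecker ComplexOrder

set_option linter.unusedSectionVars false

noncomputable section

namespace QChannel

/-- `L a` is the space of linear operators on the complex Euclidean space `ℂ^a`, as matrices;
`ℂ^a ⊗ ℂ^b` is `ℂ^(a × b)`. -/
abbrev L (a : Type*) := Matrix a a ℂ

/-- `T a b` is the space of linear maps `L a → L b`. -/
abbrev T (a b : Type*) := L a →ₗ[ℂ] L b

section Maps

variable {a b c d : Type*} [Fintype a] [DecidableEq a] [Fintype b] [DecidableEq b]
  [Fintype c] [DecidableEq c] [Fintype d] [DecidableEq d]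

/-- The tensor product `Φ ⊗ Ψ` of linear maps, under the identification
`L (a × b) = L a ⊗ L b` given by the Kronecker product. -/
def tensorMap (Φ : T a c) (Ψ : T b d) : T (a × b) (c × d) :=
  (kroneckerLinearEquiv c c d d ℂ).toLinearMap ∘ₗ TensorProduct.map Φ Ψ ∘ₗ
    (kroneckerLinearEquiv a a b b ℂ).symm.toLinearMap

theorem tensorMap_kronecker (Φ : T a c) (Ψ : T b d) (X : L a) (Y : L b) :
    tensorMap Φ Ψ (X ⊗ₖ Y) = Φ X ⊗ₖ Ψ Y := by
  simp [tensorMap]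

/-- The partial trace over the first tensor factor. -/
def traceFst : T (a × b) b where
  toFun M := Matrix.of fun j j' => ∑ i, M (i, j) (i, j')
  map_add' M N := by ext; simp [Finset.sum_add_distrib]
  map_smul' z M := by ext; simp [Finset.mul_sum]

/-- The partial trace over the second tensor factor. -/
def traceSnd : T (a × b) a where
  toFun M := Matrix.of fun i i' => ∑ j, M (i, j) (i', j)
  map_add' M N := by ext; simp [Finset.sum_add_distrib]
  map_smul' z M := by ext; simp [Finset.mul_sum]

/-- Complete positivity: `id ⊗ Φ` maps positive semidefinite operators on `ℂ^k ⊗ ℂ^a` to positive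
semidefinite operators on `ℂ^k ⊗ ℂ^b`, for every `k`. -/
def IsCompletelyPositive (Φ : T a b) : Prop :=
  ∀ (k : ℕ) (M : L (Fin k × a)), M.PosSemidef →
    (tensorMap (LinearMap.id : T (Fin k) (Fin k)) Φ M).PosSemidef

def IsTracePreserving (Φ : T a b) : Prop := ∀ X : L a, (Φ X).trace = X.trace

/-- Quantum channels. -/
def IsChannel (Φ : T a b) : Prop := IsCompletelyPositive Φ ∧ IsTracePreserving Φ

/-- The Choi representation `J(Φ) = ∑ i j, E i j ⊗ Φ (E i j)`. -/
def choi (Φ : T a b) : L (a × b) :=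
  ∑ i, ∑ j, Matrix.single i j (1 : ℂ) ⊗ₖ Φ (Matrix.single i j 1)

/-- The linear map `X ↦ Tr_a ((Xᵀ ⊗ 1) J)` with a given Choi representation `J`. -/
def ofChoi (J : L (a × b)) : T a b where
  toFun X := traceFst ((Xᵀ ⊗ₖ (1 : L b)) * J)
  map_add' X Y := by simp [Matrix.add_kronecker, add_mul]
  map_smul' z X := by simp [Matrix.smul_kronecker]

/-- Compatibility of channels: they are the two marginals of a single channel. -/
def Compatible (Φ₁ : T a b) (Φ₂ : T a c) : Prop :=
  ∃ Φ : T a (b × c), IsChannel Φ ∧ (∀ X, Φ₁ X = traceSnd (Φ X)) ∧ (∀ X, Φ₂ X = traceFst (Φ X))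

/-- The generalized Jordan product `Φ₁ ⊙_A Φ₂`: the linear map whose Choi representation is
`(id ⊗ Φ₁ ⊗ Φ₂) A`. -/
def jordanProd (A : L (a × (a × a))) (Φ₁ : T a b) (Φ₂ : T a c) : T a (b × c) :=
  ofChoi (tensorMap (LinearMap.id : T a a) (tensorMap Φ₁ Φ₂) A)

/-- The operators `A` admitted in the generalized Jordan product: `A` is a Hermitian operator on
`X ⊗ X₁ ⊗ X₂` (three copies of `ℂ^a`) with `Tr_{X₁} A = Tr_{X₂} A = ∑ i j, E i j ⊗ E i j`. -/
def IsJordanOperator (A : L (a × (a × a))) : Prop :=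
  A.IsHermitian ∧
  tensorMap (LinearMap.id : T a a) (traceFst : T (a × a) a) A =
    ∑ i, ∑ j, Matrix.single i j (1 : ℂ) ⊗ₖ Matrix.single i j (1 : ℂ) ∧
  tensorMap (LinearMap.id : T a a) (traceSnd : T (a × a) a) A =
    ∑ i, ∑ j, Matrix.single i j (1 : ℂ) ⊗ₖ Matrix.single i j (1 : ℂ)

/-- (Generalized) Jordan compatibility. -/
def JordanCompatible (Φ₁ : T a b) (Φ₂ : T a c) : Prop :=
  ∃ A : L (a × (a × a)), IsJordanOperator A ∧ IsCompletelyPositive (jordanProd A Φ₁ Φ₂)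

theorem choi_apply (Φ : T a b) (i i' : a) (j j' : b) :
    choi Φ (i, j) (i', j') = Φ (Matrix.single i i' 1) j j' := by
  simp [choi, Matrix.sum_apply, Matrix.single_apply, ite_and]

theorem choi_ofChoi (J : L (a × b)) : choi (ofChoi J) = J := by
  ext ⟨i, j⟩ ⟨i', j'⟩
  rw [choi_apply]
  simp [ofChoi, traceFst, Matrix.mul_apply, Fintype.sum_prod_type, Matrix.single_apply,
    Matrix.one_apply, ite_and]

theorem ofChoi_choi (Φ : T a b) : ofChoi (choi Φ) = Φ := by
  refine Matrix.ext_linearMap ℂ fun i i' => LinearMap.ext_ring ?_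
  ext j j'
  change ofChoi (choi Φ) (Matrix.single i i' 1) j j' = Φ (Matrix.single i i' 1) j j'
  have := congrFun₂ (choi_ofChoi (choi Φ)) (i, j) (i', j')
  simpa only [choi_apply] using this

theorem choi_add (Φ Ψ : T a b) : choi (Φ + Ψ) = choi Φ + choi Ψ := by
  ext ⟨i, j⟩ ⟨i', j'⟩; simp [choi_apply]

theorem choi_smul (r : ℝ) (Φ : T a b) : choi (r • Φ) = (r : ℂ) • choi Φ := by
  ext ⟨i, j⟩ ⟨i', j'⟩; simp [choi_apply]

theorem choi_injective : Function.Injective (choi : T a b → L (a × b)) :=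
  Function.LeftInverse.injective ofChoi_choi

end Maps

section HermitianPreserving

/-- The real vector space of Hermitian-preserving linear maps `L a → L b`. -/
def hermitianPreserving (a b : Type*) : Submodule ℝ (T a b) where
  carrier := {Φ | ∀ X : L a, X.IsHermitian → (Φ X).IsHermitian}
  zero_mem' X _ := by simp
  add_mem' hΦ hΨ X hX := (hΦ X hX).add (hΨ X hX)
  smul_mem' r Φ hΦ X hX := by
    have h := hΦ X hX
    simp only [Matrix.IsHermitian, LinearMap.smul_apply, Matrix.conjTranspose_smul, star_trivial]
      at h ⊢
    rw [h]

abbrev HP (a b : Type*) := ↥(hermitianPreserving a b)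

variable (a b c : Type*) [Fintype a] [DecidableEq a] [Fintype b] [DecidableEq b]
  [Fintype c] [DecidableEq c]

/-- The Euclidean structure of `HP a b`: the Hilbert-Schmidt inner product
`⟨Φ, Ψ⟩ = Tr (J(Φ)* J(Ψ))` of the Choi representations (which is real on Hermitian-preserving
maps). -/
@[reducible] def hpCore : InnerProductSpace.Core ℝ (HP a b) where
  inner Φ Ψ := ((choi Φ.1)ᴴ * choi Ψ.1).trace.re
  conj_inner_symm Φ Ψ := by
    have h : ((choi Φ.1)ᴴ * choi Ψ.1).trace = star ((choi Ψ.1)ᴴ * choi Φ.1).trace := by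
      rw [← Matrix.trace_conjTranspose, Matrix.conjTranspose_mul,
        Matrix.conjTranspose_conjTranspose]
    rw [h]
    simp
  re_inner_nonneg Φ := by
    have h := (Matrix.posSemidef_conjTranspose_mul_self (choi Φ.1)).trace_nonneg
    exact (Complex.le_def.1 h).1
  add_left Φ Ψ Θ := by
    simp [choi_add, add_mul]
  smul_left Φ Ψ r := by
    simp [choi_smul]
  definite Φ h := by
    have h0 := (Matrix.posSemidef_conjTranspose_mul_self (choi Φ.1)).trace_nonneg
    have h1 : ((choi Φ.1)ᴴ * choi Φ.1).trace = 0 :=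
      Complex.ext h (Complex.le_def.1 h0).2.symm
    rw [Matrix.trace_conjTranspose_mul_self_eq_zero_iff] at h1
    refine Subtype.ext (choi_injective (h1.trans ?_))
    ext ⟨i, j⟩ ⟨i', j'⟩
    simp [choi_apply]

instance : NormedAddCommGroup (HP a b) := (hpCore a b).toNormedAddCommGroup

instance : InnerProductSpace ℝ (HP a b) := InnerProductSpace.ofCore (hpCore a b).toCore

instance : FiniteDimensional ℝ (HP a b) := by
  have : Module.Finite ℝ (T a b) := Module.Finite.trans ℂ _
  infer_instance

instance : MeasurableSpace (HP a b) := borel _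

instance : BorelSpace (HP a b) := ⟨rfl⟩

/-- The Euclidean space `HP(X, Y₁) ⊕ HP(X, Y₂)`. -/
abbrev HPPairs := WithLp 2 (HP a b × HP a c)

/-- The affine space of pairs of trace-preserving maps in `HP(X, Y₁) ⊕ HP(X, Y₂)`. -/
def tpPairs : AffineSubspace ℝ (HPPairs a b c) where
  carrier := {P | IsTracePreserving P.fst.1 ∧ IsTracePreserving P.snd.1}
  smul_vsub_vadd_mem' r P Q R hP hQ hR := by
    constructor <;> intro X
    · simp [hP.1 X, hQ.1 X, hR.1 X]
    · simp [hP.2 X, hQ.2 X, hR.2 X]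

/-- Pairs of channels. -/
def CPairs : Set (HPPairs a b c) := {P | IsChannel P.fst.1 ∧ IsChannel P.snd.1}

/-- Compatible pairs of channels. -/
def Comp : Set (HPPairs a b c) := {P ∈ CPairs a b c | Compatible P.fst.1 P.snd.1}

/-- Jordan-compatible pairs of channels. -/
def JComp : Set (HPPairs a b c) := {P ∈ CPairs a b c | JordanCompatible P.fst.1 P.snd.1}

theorem CPairs_subset_tpPairs : CPairs a b c ⊆ tpPairs a b c :=
  fun _ hP => ⟨hP.1.2, hP.2.2⟩

theorem tpPairs_nonempty : (tpPairs a a a : Set (HPPairs a a a)).Nonempty := by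
  let i : HP a a := ⟨LinearMap.id, fun _ hX => hX⟩
  exact ⟨WithLp.toLp 2 (i, i), fun _ => rfl, fun _ => rfl⟩

end HermitianPreserving

section Measure

open MeasureTheory

variable {E : Type*} [NormedAddCommGroup E] [InnerProductSpace ℝ E] [FiniteDimensional ℝ E]
  [MeasurableSpace E] [BorelSpace E]

open Classical in
/-- The Lebesgue measure carried by an affine subspace `A` of a Euclidean space `E`, as a measure
on `E`: the Lebesgue measure of the direction of `A`, translated to a point of `A` (it does not
depend on the point, see `affineVolume_eq`). -/
def affineVolume (A : AffineSubspace ℝ E) : Measure E :=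
  if h : (A : Set E).Nonempty then
    (volume : Measure A.direction).map fun v : A.direction => (v : E) + h.some
  else 0

theorem affineVolume_eq (A : AffineSubspace ℝ E) {p : E} (hp : p ∈ A) :
    affineVolume A = (volume : Measure A.direction).map fun v : A.direction => (v : E) + p := by
  have h : (A : Set E).Nonempty := ⟨p, hp⟩
  have hw : h.some - p ∈ A.direction := A.vsub_mem_direction h.some_mem hp
  have hm : Measurable fun v : A.direction => (v : E) + p :=
    measurable_subtype_coe.add_const p
  rw [affineVolume, dif_pos h,
    ← (measurePreserving_add_right (volume : Measure A.direction) ⟨_, hw⟩).map_eq,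
    Measure.map_map hm (measurable_add_const _),
    (measurePreserving_add_right (volume : Measure A.direction) ⟨_, hw⟩).map_eq]
  congr 1
  ext v
  simp [add_assoc]

end Measure

end QChannel

end

noncomputable section

namespace QChannel

/-! ### Tensor products of maps, partial traces and Choi operators -/

section TensorMaps

variable {a b c d a' b' : Type*} [Fintype a] [DecidableEq a] [Fintype b] [DecidableEq b]
  [Fintype c] [DecidableEq c] [Fintype d] [DecidableEq d]
  [Fintype a'] [DecidableEq a'] [Fintype b'] [DecidableEq b']

/-! A Jordan product of two trace-preserving maps has those maps as marginals, so JComp lies in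
Comp. Conversely, if compatible channels are both invertible and `Φ` has them as marginals, then
applying id ⊗ Φ₁⁻¹ ⊗ Φ₂⁻¹ to the Choi operator of `Φ` gives an admissible `A`
(`jordanCompatible_of_injective`). Only pairs with a singular component can therefore be lost.

Such pairs are rare: the kernel of a trace-preserving map is traceless, so perturbing by `s • D`,
with `D` a nonzero scalar on traceless operators, creates a kernel only when `s` comes from an
eigenvalue (`finite_traceless_ker_add_smul`). Taking `D` = id minus depolarizing, Fubini along
parallel lines gives the null set. Taking `D` to be a marginal of `broadcast`, mixing stays inside
Comp and gives density. Finally Comp is closed, being a linear image of the compact set of channels.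
-/

theorem kronecker_linearMap_ext {V : Type*} [AddCommGroup V] [Module ℂ V]
    {f g : L (a × b) →ₗ[ℂ] V} (h : ∀ (X : L a) (Y : L b), f (X ⊗ₖ Y) = g (X ⊗ₖ Y)) : f = g := by
  have key : f ∘ₗ (kroneckerLinearEquiv a a b b ℂ).toLinearMap =
      g ∘ₗ (kroneckerLinearEquiv a a b b ℂ).toLinearMap :=
    TensorProduct.ext' fun X Y => by simpa using h X Y
  ext1 M
  simpa using LinearMap.congr_fun key ((kroneckerLinearEquiv a a b b ℂ).symm M)

theorem tensorMap_comp (Φ : T a c) (Ψ : T b d) (Φ' : T c a') (Ψ' : T d b') :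
    tensorMap (Φ' ∘ₗ Φ) (Ψ' ∘ₗ Ψ) = tensorMap Φ' Ψ' ∘ₗ tensorMap Φ Ψ :=
  kronecker_linearMap_ext fun X Y => by simp [tensorMap_kronecker]

theorem tensorMap_id_id :
    tensorMap (LinearMap.id : T a a) (LinearMap.id : T b b) = LinearMap.id :=
  kronecker_linearMap_ext fun X Y => by simp [tensorMap_kronecker]

/-- The map acts block by block, which reduces the complete positivity and continuity arguments to
entries. -/
theorem tensorMap_id_apply (Ψ : T b c) (M : L (a × b)) (k k' : a) (j j' : c) :
    tensorMap (LinearMap.id : T a a) Ψ M (k, j) (k', j') =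
      Ψ (Matrix.of fun i i' => M (k, i) (k', i')) j j' := by
  let blk : L (a × b) →ₗ[ℂ] L b :=
    { toFun := fun M => Matrix.of fun i i' => M (k, i) (k', i')
      map_add' := fun M N => by ext; simp
      map_smul' := fun z M => by ext; simp }
  have h : Matrix.entryLinearMap ℂ ℂ (k, j) (k', j') ∘ₗ tensorMap (LinearMap.id : T a a) Ψ =
      Matrix.entryLinearMap ℂ ℂ j j' ∘ₗ Ψ ∘ₗ blk := by
    refine kronecker_linearMap_ext fun X Y => ?_
    have hb : blk (X ⊗ₖ Y) = X k k' • Y := by ext; simp [blk]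
    simp [tensorMap_kronecker, hb]
  exact LinearMap.congr_fun h M

theorem choi_comp (Ψ : T b c) (Φ : T a b) :
    choi (Ψ ∘ₗ Φ) = tensorMap (LinearMap.id : T a a) Ψ (choi Φ) := by
  simp [choi, tensorMap_kronecker]

theorem traceFst_kronecker (X : L a) (Y : L b) : traceFst (X ⊗ₖ Y) = X.trace • Y := by
  ext; simp [traceFst, Matrix.trace, Finset.sum_mul]

theorem traceSnd_kronecker (X : L a) (Y : L b) : traceSnd (X ⊗ₖ Y) = Y.trace • X := by
  ext; simp [traceSnd, Matrix.trace, Finset.mul_sum, mul_comm]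

/-- On X ⊗ Y both sides equal Tr(X) Ψ(Y). This moves marginals past Φ₁ ⊗ Φ₂ and past its inverse. -/
theorem traceFst_comp_tensorMap {Φ : T a c} (hΦ : IsTracePreserving Φ) (Ψ : T b d) :
    traceFst ∘ₗ tensorMap Φ Ψ = Ψ ∘ₗ traceFst :=
  kronecker_linearMap_ext fun X Y => by simp [tensorMap_kronecker, traceFst_kronecker, hΦ X]

theorem traceSnd_comp_tensorMap (Φ : T a c) {Ψ : T b d} (hΨ : IsTracePreserving Ψ) :
    traceSnd ∘ₗ tensorMap Φ Ψ = Φ ∘ₗ traceSnd :=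
  kronecker_linearMap_ext fun X Y => by simp [tensorMap_kronecker, traceSnd_kronecker, hΨ Y]

theorem trace_traceFst (M : L (a × b)) : (traceFst M).trace = M.trace := by
  simp only [Matrix.trace, traceFst, Matrix.diag, Fintype.sum_prod_type, LinearMap.coe_mk,
    AddHom.coe_mk, Matrix.of_apply]
  exact Finset.sum_comm

theorem trace_traceSnd (M : L (a × b)) : (traceSnd M).trace = M.trace := by
  simp [Matrix.trace, traceSnd, Fintype.sum_prod_type]

end TensorMaps

/-! ### Maps commuting with the adjoint -/

section StarPreserving

variable {a b c d : Type*} [Fintype a] [DecidableEq a] [Fintype b] [DecidableEq b]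
  [Fintype c] [DecidableEq c] [Fintype d] [DecidableEq d]

/-- Compatibility with the adjoint, equivalent to preserving Hermitian operators. -/
def IsStarPreserving (Φ : T a b) : Prop := ∀ X, Φ Xᴴ = (Φ X)ᴴ

theorem IsStarPreserving.mem_hermitianPreserving {Φ : T a b} (h : IsStarPreserving Φ) :
    Φ ∈ hermitianPreserving a b := fun X hX => by
  rw [Matrix.IsHermitian, ← h X, hX]

/-- Hermiticity of the Choi operator is the claim on matrix units; expanding `X` in matrix units
gives the rest. -/
theorem isStarPreserving_of_isHermitian_choi {Φ : T a b} (h : (choi Φ).IsHermitian) :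
    IsStarPreserving Φ := by
  intro X
  have hs : ∀ i i', Φ (Matrix.single i i' 1) = (Φ (Matrix.single i' i 1))ᴴ := by
    intro i i'
    ext j j'
    have := h.apply (i, j) (i', j')
    simp only [choi_apply] at this
    simp [this]
  have hX : ∀ Y : L a, Φ Y = ∑ i, ∑ i', Y i i' • Φ (Matrix.single i i' 1) := by
    intro Y
    conv_lhs => rw [Matrix.matrix_eq_sum_single Y]
    simp only [map_sum]
    refine Finset.sum_congr rfl fun i _ => Finset.sum_congr rfl fun i' _ => ?_
    rw [← map_smul, Matrix.smul_single, smul_eq_mul, mul_one]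
  rw [hX Xᴴ, hX X, Matrix.conjTranspose_sum, Finset.sum_comm]
  refine Finset.sum_congr rfl fun i _ => ?_
  rw [Matrix.conjTranspose_sum]
  refine Finset.sum_congr rfl fun i' _ => ?_
  rw [Matrix.conjTranspose_smul, hs i' i, Matrix.conjTranspose_apply]

theorem IsStarPreserving.tensorMap {Φ : T a c} {Ψ : T b d} (hΦ : IsStarPreserving Φ)
    (hΨ : IsStarPreserving Ψ) : IsStarPreserving (tensorMap Φ Ψ) := by
  intro M
  rw [Matrix.matrix_eq_sum_single M]
  simp only [Matrix.conjTranspose_sum, map_sum]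
  refine Finset.sum_congr rfl fun p _ => Finset.sum_congr rfl fun q _ => ?_
  have h : Matrix.single p q (M p q) =
      (M p q • Matrix.single p.1 q.1 (1 : ℂ)) ⊗ₖ Matrix.single p.2 q.2 (1 : ℂ) := by
    simp [Matrix.single_kronecker_single]
  rw [h, Matrix.conjTranspose_kronecker, tensorMap_kronecker, tensorMap_kronecker, hΦ, hΨ,
    Matrix.conjTranspose_kronecker]

theorem isStarPreserving_id : IsStarPreserving (LinearMap.id : T a a) := fun _ => rfl

theorem IsStarPreserving.isHermitian {Φ : T a b} (h : IsStarPreserving Φ) {X : L a}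
    (hX : X.IsHermitian) : (Φ X).IsHermitian := h.mem_hermitianPreserving X hX

end StarPreserving

/-! ### Complete positivity and basic channels -/

section CompletelyPositive

variable {a b c : Type*} [Fintype a] [DecidableEq a] [Fintype b] [DecidableEq b]
  [Fintype c] [DecidableEq c]

theorem IsCompletelyPositive.posSemidef_choi {Φ : T a b} (h : IsCompletelyPositive Φ) :
    (choi Φ).PosSemidef := by
  let e := Fintype.equivFin a
  -- The unnormalised maximally entangled vector. Its first factor is relabelled by `e` because
  -- complete positivity is tested on `Fin k`.
  let v : Fin (Fintype.card a) × a → ℂ := fun p => if p.1 = e p.2 then 1 else 0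
  have h1 := (h _ _ (Matrix.posSemidef_vecMulVec_self_star v)).submatrix
    (fun p : a × b => (e p.1, p.2))
  convert h1 using 1
  ext ⟨i, j⟩ ⟨i', j'⟩
  rw [choi_apply, Matrix.submatrix_apply, tensorMap_id_apply]
  refine congrArg (fun X => Φ X j j') ?_
  ext x y
  simp [v, Matrix.vecMulVec_apply, Matrix.single_apply, ← ite_and, and_comm]

theorem IsCompletelyPositive.isStarPreserving {Φ : T a b} (h : IsCompletelyPositive Φ) :
    IsStarPreserving Φ :=
  isStarPreserving_of_isHermitian_choi h.posSemidef_choi.isHermitian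

theorem IsCompletelyPositive.add {Φ Ψ : T a b} (hΦ : IsCompletelyPositive Φ)
    (hΨ : IsCompletelyPositive Ψ) : IsCompletelyPositive (Φ + Ψ) := fun k M hM => by
  convert (hΦ k M hM).add (hΨ k M hM) using 1
  ext ⟨i, j⟩ ⟨i', j'⟩
  simp [tensorMap_id_apply]

theorem IsCompletelyPositive.smul {Φ : T a b} (hΦ : IsCompletelyPositive Φ) {r : ℝ}
    (hr : 0 ≤ r) : IsCompletelyPositive (r • Φ) := fun k M hM => by
  have hr' : (0 : ℂ) ≤ (r : ℂ) := by exact_mod_cast hr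
  convert (hΦ k M hM).smul hr' using 1
  ext ⟨i, j⟩ ⟨i', j'⟩
  simp [tensorMap_id_apply]

theorem IsCompletelyPositive.comp {Φ : T a b} {Ψ : T b c} (hΨ : IsCompletelyPositive Ψ)
    (hΦ : IsCompletelyPositive Φ) : IsCompletelyPositive (Ψ ∘ₗ Φ) := fun k M hM => by
  have h := hΨ k _ (hΦ k M hM)
  rwa [← LinearMap.comp_apply, ← tensorMap_comp, LinearMap.id_comp] at h

/-- The partial trace is a sum of principal submatrices, each positive semidefinite. -/
theorem isCompletelyPositive_traceFst : IsCompletelyPositive (traceFst : T (a × b) b) := by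
  intro k M hM
  have h : tensorMap (LinearMap.id : T (Fin k) (Fin k)) (traceFst : T (a × b) b) M =
      ∑ i, M.submatrix (fun p : Fin k × b => (p.1, (i, p.2))) fun p => (p.1, (i, p.2)) := by
    ext ⟨l, j⟩ ⟨l', j'⟩
    simp [tensorMap_id_apply, traceFst, Matrix.sum_apply]
  rw [h]
  exact Matrix.posSemidef_sum _ fun i _ => hM.submatrix _

theorem isCompletelyPositive_traceSnd : IsCompletelyPositive (traceSnd : T (a × b) a) := by
  intro k M hM
  have h : tensorMap (LinearMap.id : T (Fin k) (Fin k)) (traceSnd : T (a × b) a) M =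
      ∑ j, M.submatrix (fun p : Fin k × a => (p.1, (p.2, j))) fun p => (p.1, (p.2, j)) := by
    ext ⟨l, j⟩ ⟨l', j'⟩
    simp [tensorMap_id_apply, traceSnd, Matrix.sum_apply]
  rw [h]
  exact Matrix.posSemidef_sum _ fun i _ => hM.submatrix _

/-- `X ↦ X ⊗ Y`. -/
def kroneckerRight (Y : L b) : T a (a × b) where
  toFun X := X ⊗ₖ Y
  map_add' X X' := Matrix.add_kronecker X X' Y
  map_smul' z X := Matrix.smul_kronecker z X Y

/-- `X ↦ Y ⊗ X`. -/
def kroneckerLeft (Y : L b) : T a (b × a) where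
  toFun X := Y ⊗ₖ X
  map_add' X X' := Matrix.kronecker_add Y X X'
  map_smul' z X := Matrix.kronecker_smul z Y X

theorem isCompletelyPositive_kroneckerRight {Y : L b} (hY : Y.PosSemidef) :
    IsCompletelyPositive (kroneckerRight Y : T a (a × b)) := by
  intro k M hM
  have h : tensorMap (LinearMap.id : T (Fin k) (Fin k)) (kroneckerRight Y) M =
      (M ⊗ₖ Y).submatrix (fun p : Fin k × (a × b) => ((p.1, p.2.1), p.2.2)) fun p => ((p.1, p.2.1), p.2.2) := by
    ext ⟨l, i, j⟩ ⟨l', i', j'⟩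
    simp [tensorMap_id_apply, kroneckerRight]
  rw [h]
  exact (hM.kronecker hY).submatrix _

theorem isCompletelyPositive_kroneckerLeft {Y : L b} (hY : Y.PosSemidef) :
    IsCompletelyPositive (kroneckerLeft Y : T a (b × a)) := by
  intro k M hM
  have h : tensorMap (LinearMap.id : T (Fin k) (Fin k)) (kroneckerLeft Y) M =
      (Y ⊗ₖ M).submatrix (fun p : Fin k × (b × a) => (p.2.1, (p.1, p.2.2))) fun p => (p.2.1, (p.1, p.2.2)) := by
    ext ⟨l, i, j⟩ ⟨l', i', j'⟩
    simp [tensorMap_id_apply, kroneckerLeft]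
  rw [h]
  exact (hY.kronecker hM).submatrix _

theorem isTracePreserving_traceFst_comp {Φ : T a (b × c)} :
    IsTracePreserving (traceFst ∘ₗ Φ) ↔ IsTracePreserving Φ := by
  simp [IsTracePreserving, trace_traceFst]

theorem isTracePreserving_traceSnd_comp {Φ : T a (b × c)} :
    IsTracePreserving (traceSnd ∘ₗ Φ) ↔ IsTracePreserving Φ := by
  simp [IsTracePreserving, trace_traceSnd]

/-- A convex combination, normalised as `(Φ + s Ψ) / (1 + s)`. -/
theorem IsChannel.inv_smul_add_smul {Φ Ψ : T a b} (hΦ : IsChannel Φ) (hΨ : IsChannel Ψ) {s : ℝ}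
    (hs : 0 ≤ s) : IsChannel ((1 + s)⁻¹ • (Φ + s • Ψ)) := by
  refine ⟨(hΦ.1.add (hΨ.1.smul hs)).smul (by positivity), fun X => ?_⟩
  have h : (1 + (s : ℂ)) ≠ 0 := by
    have : (1 + s) ≠ 0 := by positivity
    exact_mod_cast this
  simp [Matrix.trace_add, Matrix.trace_smul, hΦ.2 X, hΨ.2 X]
  field_simp

end CompletelyPositive

/-! ### Invertible channels and Jordan compatibility -/

section Injective

variable {a b c : Type*} [Fintype a] [DecidableEq a] [Fintype b] [DecidableEq b]
  [Fintype c] [DecidableEq c]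

theorem IsTracePreserving.exists_of_not_injective {Φ : T a b} (h : IsTracePreserving Φ)
    (hi : ¬ Function.Injective Φ) : ∃ X, X ≠ 0 ∧ X.trace = 0 ∧ Φ X = 0 := by
  rw [injective_iff_map_eq_zero] at hi
  push Not at hi
  obtain ⟨X, hX, h0⟩ := hi
  exact ⟨X, h0, by rw [← h X, hX, Matrix.trace_zero], hX⟩

/-- If `D` acts as the scalar `r ≠ 0` on traceless operators, then `Φ + s D` kills a nonzero
traceless operator only if `-s r` is an eigenvalue of `Φ`, hence for finitely many `s`. -/
theorem finite_traceless_ker_add_smul (Φ D : T a a) {r : ℝ} (hr : r ≠ 0)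
    (hD : ∀ X : L a, X.trace = 0 → D X = (r : ℂ) • X) :
    {s : ℝ | ∃ X : L a, X ≠ 0 ∧ X.trace = 0 ∧ (Φ + s • D) X = 0}.Finite := by
  -- Distinct `s` give distinct candidate eigenvalues, so finiteness of the spectrum pulls back to
  -- `s`.
  have hinj : Set.InjOn (fun s : ℝ => -((s * r : ℝ) : ℂ))
      ((fun s : ℝ => -((s * r : ℝ) : ℂ)) ⁻¹' {μ | Module.End.HasEigenvalue Φ μ}) := by
    intro s _ t _ hst
    have : s * r = t * r := by exact_mod_cast neg_injective hst
    exact mul_right_cancel₀ hr this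
  refine ((Module.End.finite_hasEigenvalue Φ).preimage hinj).subset ?_
  rintro s ⟨X, hX0, hX, h⟩
  refine Module.End.hasEigenvalue_of_hasEigenvector (x := X)
    (Module.End.hasEigenvector_iff.2 ⟨Module.End.mem_eigenspace_iff.2 ?_, hX0⟩)
  rw [LinearMap.add_apply, LinearMap.smul_apply, hD X hX] at h
  rw [eq_neg_of_add_eq_zero_left h]
  ext i j
  simp [mul_assoc]

theorem exists_inverse {Φ : T a a} (h : Function.Injective Φ) :
    ∃ Ψ : T a a, Ψ ∘ₗ Φ = LinearMap.id ∧ Φ ∘ₗ Ψ = LinearMap.id := by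
  let e := LinearEquiv.ofInjectiveEndo Φ h
  have he : (e : T a a) = Φ := by ext1; rfl
  refine ⟨e.symm, ?_, ?_⟩
  · rw [← he]; ext1 X; exact e.symm_apply_apply X
  · rw [← he]; ext1 X; exact e.apply_symm_apply X

theorem IsTracePreserving.of_comp_eq_id {Φ Ψ : T a a} (hΦ : IsTracePreserving Φ)
    (h : Φ ∘ₗ Ψ = LinearMap.id) : IsTracePreserving Ψ := fun X => by
  rw [← hΦ (Ψ X), ← LinearMap.comp_apply, h, LinearMap.id_apply]

theorem IsStarPreserving.of_comp_eq_id {Φ Ψ : T a a} (hΦ : IsStarPreserving Φ)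
    (hi : Function.Injective Φ) (h : Φ ∘ₗ Ψ = LinearMap.id) : IsStarPreserving Ψ := fun X => by
  have h' : ∀ Y, Φ (Ψ Y) = Y := LinearMap.congr_fun h
  exact hi (by rw [hΦ, h', h'])

theorem choi_id : choi (LinearMap.id : T a a) =
    ∑ i, ∑ j, Matrix.single i j (1 : ℂ) ⊗ₖ Matrix.single i j (1 : ℂ) := rfl

theorem jordanCompatible_of_injective {Φ₁ Φ₂ : T a a} (h₁ : IsChannel Φ₁) (h₂ : IsChannel Φ₂)
    (h : Compatible Φ₁ Φ₂) (hi₁ : Function.Injective Φ₁) (hi₂ : Function.Injective Φ₂) :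
    JordanCompatible Φ₁ Φ₂ := by
  obtain ⟨Φ, hΦ, hm₁, hm₂⟩ := h
  obtain ⟨Ψ₁, hl₁, hr₁⟩ := exists_inverse hi₁
  obtain ⟨Ψ₂, hl₂, hr₂⟩ := exists_inverse hi₂
  have e₁ : Φ₁ = traceSnd ∘ₗ Φ := LinearMap.ext hm₁
  have e₂ : Φ₂ = traceFst ∘ₗ Φ := LinearMap.ext hm₂
  have hstar : IsStarPreserving (tensorMap (LinearMap.id : T a a) (tensorMap Ψ₁ Ψ₂)) :=
    isStarPreserving_id.tensorMap
      ((h₁.1.isStarPreserving.of_comp_eq_id hi₁ hr₁).tensorMap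
        (h₂.1.isStarPreserving.of_comp_eq_id hi₂ hr₂))
  -- With this `A` the Jordan product is `Φ` itself, and each marginal of `A` is the Choi operator
  -- of Ψᵢ ∘ Φᵢ = id.
  refine ⟨choi (tensorMap Ψ₁ Ψ₂ ∘ₗ Φ), ⟨?_, ?_, ?_⟩, ?_⟩
  · rw [choi_comp]
    exact hstar.isHermitian hΦ.1.posSemidef_choi.isHermitian
  · rw [← choi_comp, ← choi_id, ← LinearMap.comp_assoc,
      traceFst_comp_tensorMap (h₁.2.of_comp_eq_id hr₁), LinearMap.comp_assoc, ← e₂, hl₂]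
  · rw [← choi_comp, ← choi_id, ← LinearMap.comp_assoc,
      traceSnd_comp_tensorMap _ (h₂.2.of_comp_eq_id hr₂), LinearMap.comp_assoc, ← e₁, hl₁]
  · rw [jordanProd, ← choi_comp, ← LinearMap.comp_assoc, ← tensorMap_comp, hr₁, hr₂,
      tensorMap_id_id, LinearMap.id_comp, ofChoi_choi]
    exact hΦ.1

/-- Tracing out one output removes the trace-preserving map acting there and leaves the other map
applied to the Choi operator of the identity. The product preserves trace because a marginal does.
-/
theorem compatible_of_jordanCompatible {Φ₁ : T a b} {Φ₂ : T a c} (h₁ : IsTracePreserving Φ₁)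
    (h₂ : IsTracePreserving Φ₂) (h : JordanCompatible Φ₁ Φ₂) : Compatible Φ₁ Φ₂ := by
  obtain ⟨A, ⟨-, hA₁, hA₂⟩, hcp⟩ := h
  have e₁ : Φ₁ = traceSnd ∘ₗ jordanProd A Φ₁ Φ₂ := by
    apply choi_injective
    rw [choi_comp, jordanProd, choi_ofChoi, ← LinearMap.comp_apply, ← tensorMap_comp,
      traceSnd_comp_tensorMap _ h₂, tensorMap_comp, LinearMap.comp_apply, hA₂, ← choi_id,
      ← choi_comp, LinearMap.comp_id]
  have e₂ : Φ₂ = traceFst ∘ₗ jordanProd A Φ₁ Φ₂ := by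
    apply choi_injective
    rw [choi_comp, jordanProd, choi_ofChoi, ← LinearMap.comp_apply, ← tensorMap_comp,
      traceFst_comp_tensorMap h₁, tensorMap_comp, LinearMap.comp_apply, hA₁, ← choi_id,
      ← choi_comp, LinearMap.comp_id]
  refine ⟨jordanProd A Φ₁ Φ₂, ⟨hcp, ?_⟩, LinearMap.congr_fun e₁, LinearMap.congr_fun e₂⟩
  rw [← isTracePreserving_traceSnd_comp, ← e₁]
  exact h₁

end Injective

/-! ### Depolarizing and broadcasting maps -/

section Broadcast

variable (a : Type*) [Fintype a] [DecidableEq a]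

/-- The maximally mixed state. -/
def mixedState : L a := ((Fintype.card a : ℝ)⁻¹ : ℂ) • 1

theorem posSemidef_mixedState : (mixedState a).PosSemidef := by
  have h : (0 : ℂ) ≤ ((Fintype.card a : ℝ)⁻¹ : ℂ) := by
    rw [← Complex.ofReal_inv]
    exact Complex.zero_le_real.2 (by positivity)
  exact Matrix.PosSemidef.one.smul h

theorem trace_mixedState [Nonempty a] : (mixedState a).trace = 1 := by
  simp [mixedState]

/-- The completely depolarizing channel. -/
def depolarizing : T a a := traceSnd ∘ₗ kroneckerLeft (mixedState a)

theorem depolarizing_apply (X : L a) : depolarizing a X = X.trace • mixedState a :=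
  traceSnd_kronecker _ _

theorem isCompletelyPositive_depolarizing : IsCompletelyPositive (depolarizing a) :=
  isCompletelyPositive_traceSnd.comp (isCompletelyPositive_kroneckerLeft (posSemidef_mixedState a))

/-- A channel whose two marginals are equal and invertible. -/
def broadcast : T a (a × a) :=
  (1 / 2 : ℝ) • (kroneckerRight (mixedState a) + kroneckerLeft (mixedState a))

theorem isChannel_broadcast [Nonempty a] : IsChannel (broadcast a) := by
  refine ⟨((isCompletelyPositive_kroneckerRight (posSemidef_mixedState a)).add
    (isCompletelyPositive_kroneckerLeft (posSemidef_mixedState a))).smul (by norm_num),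
    fun X => ?_⟩
  simp [broadcast, kroneckerRight, kroneckerLeft, Matrix.trace_add, Matrix.trace_smul,
    Matrix.trace_kronecker, trace_mixedState]
  ring

theorem traceSnd_broadcast [Nonempty a] {X : L a} (hX : X.trace = 0) :
    traceSnd (broadcast a X) = ((1 / 2 : ℝ) : ℂ) • X := by
  have h : broadcast a X = ((1 / 2 : ℝ) : ℂ) • (X ⊗ₖ mixedState a + mixedState a ⊗ₖ X) := by
    ext; simp [broadcast, kroneckerRight, kroneckerLeft, mul_add]
  rw [h, map_smul, map_add, traceSnd_kronecker, traceSnd_kronecker, hX, trace_mixedState]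
  simp

theorem traceFst_broadcast [Nonempty a] {X : L a} (hX : X.trace = 0) :
    traceFst (broadcast a X) = ((1 / 2 : ℝ) : ℂ) • X := by
  have h : broadcast a X = ((1 / 2 : ℝ) : ℂ) • (X ⊗ₖ mixedState a + mixedState a ⊗ₖ X) := by
    ext; simp [broadcast, kroneckerRight, kroneckerLeft, mul_add]
  rw [h, map_smul, map_add, traceFst_kronecker, traceFst_kronecker, hX, trace_mixedState]
  simp

end Broadcast

/-! ### Compactness of channels, closedness of Comp, openness of invertibility -/

section Topology

variable {a b c : Type*} [Fintype a] [DecidableEq a] [Fintype b] [DecidableEq b]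
  [Fintype c] [DecidableEq c]

theorem continuous_hp_apply (X : L a) (j j' : b) :
    Continuous fun Φ : HP a b => Φ.1 X j j' := by
  let f : HP a b →ₗ[ℝ] ℂ :=
    { toFun := fun Φ => Φ.1 X j j'
      map_add' := fun Φ Ψ => by simp
      map_smul' := fun r Φ => by simp }
  exact f.continuous_of_finiteDimensional

theorem isClosed_setOf_isChannel : IsClosed {Φ : HP a b | IsChannel Φ.1} := by
  simp only [IsChannel, IsCompletelyPositive, IsTracePreserving, Set.ofPred_and, Set.ofPred_forall]
  refine IsClosed.inter (isClosed_iInter fun k => isClosed_iInter fun M => isClosed_iInter fun _ =>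
    ?_) (isClosed_iInter fun X => ?_)
  · have hc : Continuous fun Φ : HP a b => tensorMap (LinearMap.id : T (Fin k) (Fin k)) Φ.1 M := by
      refine continuous_matrix fun p q => ?_
      obtain ⟨l, j⟩ := p
      obtain ⟨l', j'⟩ := q
      simp only [tensorMap_id_apply]
      exact continuous_hp_apply _ _ _
    simp only [Matrix.posSemidef_iff_dotProduct_mulVec, Set.ofPred_and, Set.ofPred_forall]
    refine (isClosed_eq hc.matrix_conjTranspose hc).inter (isClosed_iInter fun x => ?_)
    exact isClosed_le continuous_const
      (continuous_const.dotProduct (hc.matrix_mulVec continuous_const))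
  · refine isClosed_eq ?_ continuous_const
    exact continuous_finsetSum _ fun j _ => continuous_hp_apply _ _ _

/-- This is nonnegativity of the 2 × 2 determinant on indices `i`, `j`; repetition is harmless. -/
theorem _root_.Matrix.PosSemidef.normSq_apply_le {M : L a} (hM : M.PosSemidef) (i j : a) :
    Complex.normSq (M i j) ≤ (M i i).re * (M j j).re := by
  have h := (hM.submatrix ![i, j]).det_nonneg
  rw [Matrix.det_fin_two] at h
  have hij : M j i = star (M i j) := (hM.isHermitian.apply j i).symm
  have hi := (Complex.le_def.1 (hM.diag_nonneg (i := i))).2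
  have h := (Complex.le_def.1 h).1
  simp [hij, Complex.mul_re, ← hi] at h
  rw [Complex.normSq_apply]
  linarith

/-- The Hilbert–Schmidt norm of a positive semidefinite operator is at most its trace, and the Choi
operator of a channel has trace `card a`. -/
theorem norm_sq_le_of_isChannel {Φ : HP a b} (h : IsChannel Φ.1) :
    ‖Φ‖ ^ 2 ≤ (Fintype.card a : ℝ) ^ 2 := by
  have hp := h.1.posSemidef_choi
  have htr : (choi Φ.1).trace = Fintype.card a := by
    have : ∀ i : a, ∑ j, choi Φ.1 (i, j) (i, j) = 1 := fun i => by
      simpa [choi_apply, Matrix.trace] using h.2 (Matrix.single i i 1)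
    simp [Matrix.trace, Fintype.sum_prod_type, this]
  have hre : ∑ p, (choi Φ.1 p p).re = Fintype.card a := by
    have := congrArg Complex.re htr
    simpa [Matrix.trace] using this
  rw [← real_inner_self_eq_norm_sq]
  change ((choi Φ.1)ᴴ * choi Φ.1).trace.re ≤ _
  calc ((choi Φ.1)ᴴ * choi Φ.1).trace.re
      = ∑ q, ∑ p, Complex.normSq (choi Φ.1 p q) := by
        simp [Matrix.trace, Matrix.mul_apply, Complex.normSq_apply]
    _ ≤ ∑ q, ∑ p, (choi Φ.1 p p).re * (choi Φ.1 q q).re :=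
        Finset.sum_le_sum fun q _ => Finset.sum_le_sum fun p _ => hp.normSq_apply_le p q
    _ = (Fintype.card a : ℝ) ^ 2 := by
        simp_rw [← Finset.sum_mul, ← Finset.mul_sum, hre]
        ring

theorem isCompact_setOf_isChannel : IsCompact {Φ : HP a b | IsChannel Φ.1} := by
  refine Metric.isCompact_of_isClosed_isBounded isClosed_setOf_isChannel ?_
  refine (Metric.isBounded_closedBall (x := (0 : HP a b)) (r := Fintype.card a)).subset ?_
  intro Φ hΦ
  rw [mem_closedBall_zero_iff]
  exact le_of_sq_le_sq (norm_sq_le_of_isChannel hΦ) (by positivity)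

/-- Composition with a Hermitian-preserving map. -/
def HP.postcomp {Ψ : T b c} (hΨ : IsStarPreserving Ψ) : HP a b →ₗ[ℝ] HP a c where
  toFun Φ := ⟨Ψ ∘ₗ Φ.1, fun X hX => hΨ.isHermitian (Φ.2 X hX)⟩
  map_add' Φ Φ' := Subtype.ext (LinearMap.comp_add _ _ _)
  map_smul' r Φ := Subtype.ext (by ext1 X; ext; simp)

variable (a b c) in
/-- The pair of marginals. -/
def marginals : HP a (b × c) →ₗ[ℝ] HPPairs a b c :=
  (WithLp.linearEquiv 2 ℝ (HP a b × HP a c)).symm.toLinearMap ∘ₗ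
    (HP.postcomp isCompletelyPositive_traceSnd.isStarPreserving).prod
      (HP.postcomp isCompletelyPositive_traceFst.isStarPreserving)

/-- This transfers compactness and mixing from channels to compatible pairs. -/
theorem Comp_eq_image :
    Comp a b c = marginals a b c '' {Φ | IsChannel Φ.1} := by
  ext P
  constructor
  · rintro ⟨-, Φ, hΦ, h₁, h₂⟩
    refine ⟨⟨Φ, hΦ.1.isStarPreserving.mem_hermitianPreserving⟩, hΦ, ?_⟩
    refine WithLp.ofLp_injective 2 (Prod.ext (Subtype.ext ?_) (Subtype.ext ?_))
    · exact (LinearMap.ext h₁).symm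
    · exact (LinearMap.ext h₂).symm
  · rintro ⟨Φ, hΦ, rfl⟩
    refine ⟨⟨⟨?_, ?_⟩, ⟨?_, ?_⟩⟩, Φ.1, hΦ, fun _ => rfl, fun _ => rfl⟩
    · exact isCompletelyPositive_traceSnd.comp hΦ.1
    · exact isTracePreserving_traceSnd_comp.2 hΦ.2
    · exact isCompletelyPositive_traceFst.comp hΦ.1
    · exact isTracePreserving_traceFst_comp.2 hΦ.2

theorem isClosed_Comp : IsClosed (Comp a b c) := by
  rw [Comp_eq_image]
  exact (isCompact_setOf_isChannel.image
    (marginals a b c).continuous_of_finiteDimensional).isClosed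

/-- Injectivity of an endomorphism is nonvanishing of a determinant that is continuous in the map.
-/
theorem isOpen_setOf_injective : IsOpen {Φ : HP a a | Function.Injective Φ.1} := by
  let B := Matrix.stdBasis ℂ a a
  have h : ∀ Φ : HP a a, Function.Injective Φ.1 ↔ (LinearMap.toMatrix B B Φ.1).det ≠ 0 := by
    intro Φ
    rw [LinearMap.det_toMatrix, ← isUnit_iff_ne_zero, ← LinearMap.isUnit_iff_isUnit_det,
      LinearMap.isUnit_iff_ker_eq_bot, LinearMap.ker_eq_bot]
  simp only [h]
  refine isOpen_ne.preimage (Continuous.matrix_det (continuous_matrix fun p q => ?_))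
  let f : HP a a →ₗ[ℝ] ℂ :=
    { toFun := fun Φ => LinearMap.toMatrix B B Φ.1 p q
      map_add' := fun Φ Ψ => by simp
      map_smul' := fun r Φ => by
        have h' : (r • Φ : HP a a).1 = (r : ℂ) • Φ.1 := (Complex.coe_smul r Φ.1).symm
        rw [h', map_smul]
        simp }
  exact f.continuous_of_finiteDimensional

end Topology

/-! ### Density and full measure -/

section Main

open MeasureTheory Filter Topology

variable (a : Type*) [Fintype a] [DecidableEq a]

theorem JComp_subset_Comp : JComp a a a ⊆ Comp a a a := fun _ hP =>
  ⟨hP.1, compatible_of_jordanCompatible hP.1.1.2 hP.1.2.2 hP.2⟩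

/-- The pairs of invertible maps. -/
def injPairs : Set (HPPairs a a a) :=
  {P | Function.Injective P.fst.1 ∧ Function.Injective P.snd.1}

theorem Comp_inter_injPairs_subset : Comp a a a ∩ injPairs a ⊆ JComp a a a := fun _ hP =>
  ⟨hP.1.1, jordanCompatible_of_injective hP.1.1.1 hP.1.1.2 hP.1.2 hP.2.1 hP.2.2⟩

theorem isOpen_injPairs : IsOpen (injPairs a) := by
  have hc : Continuous fun P : HPPairs a a a => WithLp.ofLp P := WithLp.prod_continuous_ofLp 2 _ _
  exact (isOpen_setOf_injective.preimage (continuous_fst.comp hc)).inter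
    (isOpen_setOf_injective.preimage (continuous_snd.comp hc))

variable {a} in
/-- If the components of `Q` act as `r ≠ 0` on traceless operators, then `P + s Q` is a pair of
invertible maps for all but finitely many of the `s` for which it has a trace-preserving multiple. -/
theorem finite_not_mem_injPairs (P Q : HPPairs a a a) {r : ℝ} (hr : r ≠ 0)
    (h₁ : ∀ X : L a, X.trace = 0 → Q.fst.1 X = (r : ℂ) • X)
    (h₂ : ∀ X : L a, X.trace = 0 → Q.snd.1 X = (r : ℂ) • X) :
    ∃ F : Set ℝ, F.Finite ∧ ∀ s ∉ F, ∀ t : ℝ, t ≠ 0 → t • (P + s • Q) ∈ tpPairs a a a →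
      t • (P + s • Q) ∈ injPairs a := by
  refine ⟨_, (finite_traceless_ker_add_smul P.fst.1 Q.fst.1 hr h₁).union
    (finite_traceless_ker_add_smul P.snd.1 Q.snd.1 hr h₂), fun s hs t ht htp => ?_⟩
  rw [Set.mem_union, not_or] at hs
  constructor
  · by_contra hi
    obtain ⟨X, h0, hX, h⟩ := htp.1.exists_of_not_injective hi
    exact hs.1 ⟨X, h0, hX, (smul_eq_zero.1 h).resolve_left ht⟩
  · by_contra hi
    obtain ⟨X, h0, hX, h⟩ := htp.2.exists_of_not_injective hi
    exact hs.2 ⟨X, h0, hX, (smul_eq_zero.1 h).resolve_left ht⟩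

theorem Comp_subset_closure_JComp [Nonempty a] : Comp a a a ⊆ closure (JComp a a a) := by
  intro P hP
  rw [Comp_eq_image] at hP
  obtain ⟨Φ, hΦ, rfl⟩ := hP
  let B : HP a (a × a) :=
    ⟨broadcast a, (isChannel_broadcast a).1.isStarPreserving.mem_hermitianPreserving⟩
  obtain ⟨F, hF, hinj⟩ := finite_not_mem_injPairs (marginals a a a Φ) (marginals a a a B)
    (r := 1 / 2) (by norm_num) (fun X hX => traceSnd_broadcast a hX)
    (fun X hX => traceFst_broadcast a hX)
  -- For `s ≥ 0` these are the marginals of a convex combination of `Φ` and `broadcast`; the nonzero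
  -- factor does not affect kernels.
  let γ : ℝ → HPPairs a a a := fun s =>
    (1 + s)⁻¹ • (marginals a a a Φ + s • marginals a a a B)
  have hγ : Tendsto γ (𝓝[>] 0) (𝓝 (marginals a a a Φ)) := by
    have hc : ContinuousAt γ 0 := by
      have hi : ContinuousAt (fun s : ℝ => (1 + s)⁻¹) 0 :=
        ContinuousAt.inv₀ (by fun_prop) (by norm_num)
      exact hi.smul (by fun_prop)
    have h0 : γ 0 = marginals a a a Φ := by simp [γ]
    rw [← h0]
    exact hc.tendsto.mono_left nhdsWithin_le_nhds
  refine mem_closure_of_tendsto hγ ?_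
  -- The exceptional set may contain 0, so the limit is taken over `s > 0`.
  have hFe : ∀ᶠ s in 𝓝[>] (0 : ℝ), s ∉ F :=
    (nhdsGT_le_nhdsNE 0).trans (nhdsNE_le_cofinite 0) hF.compl_mem_cofinite
  filter_upwards [hFe, self_mem_nhdsWithin] with s hs hs0
  have hs0 : 0 < s := hs0
  have hmem : γ s ∈ Comp a a a := by
    rw [Comp_eq_image]
    exact ⟨(1 + s)⁻¹ • (Φ + s • B), hΦ.inv_smul_add_smul (isChannel_broadcast a) hs0.le,
      by simp [γ]⟩
  exact Comp_inter_injPairs_subset a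
    ⟨hmem, hinj s hs _ (by positivity) (CPairs_subset_tpPairs a a a hmem.1)⟩

/-- Fubini: it suffices that each line parallel to `Q` meets the singular pairs in a null set, and
here it meets them in a finite one. -/
theorem affineVolume_compl_injPairs [Nonempty a] :
    affineVolume (tpPairs a a a) (injPairs a)ᶜ = 0 := by
  obtain ⟨p, hp⟩ := tpPairs_nonempty a
  have hme : MeasurableEmbedding fun v : (tpPairs a a a).direction => (v : HPPairs a a a) + p :=
    (MeasurableEquiv.addRight p).measurableEmbedding.comp
      (MeasurableEmbedding.subtype_coe
        (Submodule.closed_of_finiteDimensional (tpPairs a a a).direction).measurableSet)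
  rw [affineVolume_eq _ hp, hme.map_apply]
  -- A difference of trace-preserving maps, hence tangent to the affine space; depolarizing kills
  -- traceless operators, so `D` is the identity on them.
  let D : HP a a := ⟨LinearMap.id, isStarPreserving_id.mem_hermitianPreserving⟩ -
    ⟨depolarizing a,
      (isCompletelyPositive_depolarizing a).isStarPreserving.mem_hermitianPreserving⟩
  have hD : ∀ X, D.1 X = X - X.trace • mixedState a := fun X =>
    congrArg (X - ·) (depolarizing_apply a X)
  have hD0 : ∀ X : L a, X.trace = 0 → D.1 X = ((1 : ℝ) : ℂ) • X := fun X hX => by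
    simp [hD, hX]
  have hDt : ∀ X, (D.1 X).trace = 0 := fun X => by
    simp [hD, Matrix.trace_sub, trace_mixedState]
  let Q : HPPairs a a a := WithLp.toLp 2 (D, D)
  have hQ : Q ∈ (tpPairs a a a).direction := by
    rw [← AffineSubspace.vadd_mem_iff_mem_direction _ hp]
    constructor <;> intro X
    · simp [Q, Matrix.trace_add, hDt, hp.1 X]
    · simp [Q, Matrix.trace_add, hDt, hp.2 X]
  let ℓ : ℝ →ₗ[ℝ] (tpPairs a a a).direction := LinearMap.toSpanSingleton ℝ _ ⟨Q, hQ⟩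
  have hae := ae_mem_of_ae_add_linearMap_mem ℓ (volume : Measure ℝ)
    (volume : Measure (tpPairs a a a).direction)
    (s := (fun v : (tpPairs a a a).direction => (v : HPPairs a a a) + p) ⁻¹' injPairs a)
    (hme.measurable (isOpen_injPairs a).measurableSet) ?_
  · exact hae
  · intro y
    obtain ⟨F, hF, hinj⟩ := finite_not_mem_injPairs ((y : HPPairs a a a) + p) Q (r := 1)
      one_ne_zero hD0 hD0
    filter_upwards [hF.countable.ae_notMem volume] with s hs
    have he : ((y + ℓ s : (tpPairs a a a).direction) : HPPairs a a a) + p =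
        (1 : ℝ) • ((y : HPPairs a a a) + p + s • Q) := by
      simp [ℓ]; abel
    rw [Set.mem_preimage, he]
    refine hinj s hs 1 one_ne_zero ?_
    rw [← he]
    exact AffineSubspace.vadd_mem_of_mem_direction (y + ℓ s).2 hp

end Main

end QChannel

end

theorem theorem6p9 (ι : Type*) [Fintype ι] [DecidableEq ι] [Nonempty ι] :
    QChannel.affineVolume (QChannel.tpPairs ι ι ι)
        (QChannel.Comp ι ι ι \ QChannel.JComp ι ι ι) = 0 ∧
      closure (QChannel.JComp ι ι ι) = QChannel.Comp ι ι ι := by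
  refine ⟨MeasureTheory.measure_mono_null ?_
    (QChannel.affineVolume_compl_injPairs ι), ?_⟩
  · exact fun P hP hi => hP.2 (QChannel.Comp_inter_injPairs_subset ι ⟨hP.1, hi⟩)
  · exact (closure_minimal (QChannel.JComp_subset_Comp ι) QChannel.isClosed_Comp).antisymm
      (QChannel.Comp_subset_closure_JComp ι)
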